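/- Let $k$ be an algebraically closed field of characteristic $0$, let $X$ be a nonsingular variety over $k$ (for instance a projective one) with a Poisson structure $\Lambda_0$, i.e. a Poisson $k$-algebra bracket $\{-,-\}$ on $\mathcal{O}_X$, and let $(L,\nabla)$ be a Poisson invertible sheaf on $(X,\Lambda_0)$: an invertible $\mathcal{O}_X$-module $L$ with a flat Poisson connection, i.e. a $k$-bilinear bracket $\{-,-\}_L:\mathcal{O}_X\otimes_k L\to L$ with $\{fg,s\}_L=f\{g,s\}_L+g\{f,s\}_L$, $\{f,gs\}_L=\{f,g\}s+g\{f,s\}_L$ and $\{f,\{g,s\}_L\}_L=\{\{f,g\},s\}_L+\{g,\{f,s\}_L\}_L$. Write $L^\bullet$ for the complex $L\xrightarrow{v_0}T_X\otimes L\xrightarrow{v_1}\wedge^2T_X\otimes L\to\cdots$, where $T_X\otimes L$ and $\wedge^2T_X\otimes L$ are identified with the sheaves of derivations and of alternating biderivations from $\mathcal{O}_X$ to $L$, $v_0(s)(f)=\{f,s\}_L$ and $v_1(\delta)(f,g)=\{f,\delta(g)\}_L-\{g,\delta(f)\}_L-\delta(\{f,g\})$; write $\mathcal{O}_X^\bullet$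 for the complex obtained in this way from $L=\mathcal{O}_X$ with $\{-,-\}_L=\{-,-\}$ (the Lichnerowicz–Poisson complex), and $\mathbb{H}^i(X,\Lambda_0,L^\bullet,\nabla)$, $\mathbb{H}^i(X,\Lambda_0,\mathcal{O}_X^\bullet)$ for the hypercohomology groups. Elements of $\mathbb{H}^1$ are represented by Čech cocycles $(\{a_{ij}\},\{w_i\})$ of degree-$0$ terms on $U_{ij}$ and degree-$1$ terms on $U_i$ with $a_{ij}+a_{jk}=a_{ik}$, $v_0(a_{ij})=w_j-w_i$, $v_1(w_i)=0$, and the coboundaries are the $(\{t_j-t_i\},\{v_0(t_i)\})$. For $s\in\mathbb{H}^0(X,\Lambda_0,L^\bullet,\nabla)$, i.e. $s\in\Gamma(X,L)$ with $\nabla s=0$, the maps $a\mapsto a\otimes s$ form a morphism of complexes $\mathcal{O}_X^\bullet\to L^\bullet$ and induce $$m_1:\mathbb{H}^1(X,\Lambda_0,\mathcal{O}_X^\bullet)\to \mathrm{Hom}\big(\mathbb{H}^0(X,\Lambda_0,L^\bullet,\nabla),\mathbb{H}^1(X,\Lambda_0,L^\bullet,\nabla)\big).$$ Let $(\mathcal{L}_a,\nabla_a)$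 be a first-order deformation of $(L,\nabla)$: a Poisson invertible sheaf over $k[\epsilon]$ ($\epsilon^2=0$) on $X\times\mathrm{Spec}\,k[\epsilon]$ with the $k[\epsilon]$-bilinear extension of $\{-,-\}$, together with an identification of its restriction to $X$ with $(L,\nabla)$. Suppose that it corresponds to $a\in\mathbb{H}^1(X,\Lambda_0,\mathcal{O}_X^\bullet)$: on some open cover $\{U_i\}$ it has local generators $e_i$ with $e_j=(f_{ij}+\epsilon g_{ij})e_i$ and $\{h,e_i\}=(T_i(h)+\epsilon W_i(h))e_i$ for $h\in\mathcal{O}_X$, where $f_{ij}$ is invertible and $T_i,W_i$ are vector fields on $U_i$, and $a$ is the class of the cocycle $(\{g_{ij}/f_{ij}\},\{W_i\})$. Then a section $s\in\mathbb{H}^0(X,\Lambda_0,L^\bullet,\nabla)$ extends to $(\mathcal{L}_a,\nabla_a)$, that is, $s$ lies in the image of the restriction map $\mathbb{H}^0(X\times \mathrm{Spec}\,k[\epsilon],\Lambda_0,\mathcal{L}_a^\bullet,\nabla_a)\to\mathbb{H}^0(X,\Lambda_0,L^\bullet,\nabla)$, if and only if $m_1(a)(s)=0$ in $\mathbb{H}^1(X,\Lambda_0,L^\bullet,\nabla)$.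 -/

import Mathlib

open CategoryTheory TopologicalSpace Opposite AlgebraicGeometry

universe u

noncomputable section

namespace PoissonSheaf

/-! ### Spaces with a sheaf of commutative `K`-algebras and sheaves of modules on them -/

/-- A topological space with a sheaf of commutative `K`-algebras; the `K`-algebra structure
is given by the ring homomorphism from `K` to the global functions. -/
structure AlgSpace (K : Type u) [CommRing K] where
  space : TopCat.{u}
  sheaf : TopCat.Sheaf CommRingCat.{u} space
  scalar : K →+* sheaf.presheaf.obj (op ⊤)

namespace AlgSpace

variable {K : Type u} [CommRing K] (S : AlgSpace K)

/-- The ring of functions on an open set. -/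
def Fn (U : Opens S.space) : Type u := S.sheaf.presheaf.obj (op U)

instance (U : Opens S.space) : CommRing (S.Fn U) :=
  inferInstanceAs (CommRing (S.sheaf.presheaf.obj (op U)))

/-- Restriction of functions. -/
def res {U V : Opens S.space} (h : V ≤ U) : S.Fn U →+* S.Fn V :=
  (S.sheaf.presheaf.map (homOfLE h).op).hom

/-- Elements of `K` as functions on an open set. -/
def const (U : Opens S.space) : K →+* S.Fn U := (S.res le_top).comp S.scalar

/-- The structure sheaf as a sheaf of rings. -/
abbrev ringSheaf : Sheaf (Opens.grothendieckTopology S.space) RingCat.{u} :=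
  (sheafCompose _ (forget₂ CommRingCat RingCat.{u})).obj S.sheaf

/-- Sheaves of modules over the structure sheaf. -/
abbrev Modules := SheafOfModules.{u} S.ringSheaf

variable {S}

/-- The sections of a sheaf of modules on an open set. -/
def Sec (M : S.Modules) (U : Opens S.space) : Type u := M.val.presheaf.obj (op U)

instance (M : S.Modules) (U : Opens S.space) : AddCommGroup (Sec M U) :=
  inferInstanceAs (AddCommGroup (M.val.presheaf.obj (op U)))

instance (M : S.Modules) (U : Opens S.space) : Module (S.Fn U) (Sec M U) :=
  inferInstanceAs (Module (S.ringSheaf.obj.obj (op U)) (M.val.obj (op U)))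

/-- Restriction of sections. -/
def resM (M : S.Modules) {U V : Opens S.space} (h : V ≤ U) : Sec M U →+ Sec M V :=
  (M.val.presheaf.map (homOfLE h).op).hom

theorem res_res {U V W : Opens S.space} (h : V ≤ U) (h' : W ≤ V) (f : S.Fn U) :
    S.res h' (S.res h f) = S.res (h'.trans h) f := by
  change (S.sheaf.presheaf.map (homOfLE h).op ≫ S.sheaf.presheaf.map (homOfLE h').op).hom f = _
  rw [← Functor.map_comp]; rfl

theorem res_self {U : Opens S.space} (f : S.Fn U) : S.res le_rfl f = f := by
  change (S.sheaf.presheaf.map (𝟙 (op U))).hom f = _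
  rw [CategoryTheory.Functor.map_id]; rfl

theorem res_const {U V : Opens S.space} (h : V ≤ U) (c : K) :
    S.res h (S.const U c) = S.const V c := res_res _ _ _

theorem resM_resM (M : S.Modules) {U V W : Opens S.space} (h : V ≤ U) (h' : W ≤ V) (m : Sec M U) :
    resM M h' (resM M h m) = resM M (h'.trans h) m := by
  change (M.val.presheaf.map (homOfLE h).op ≫ M.val.presheaf.map (homOfLE h').op).hom m = _
  rw [← Functor.map_comp]; rfl

theorem resM_self (M : S.Modules) {U : Opens S.space} (m : Sec M U) : resM M le_rfl m = m := by
  change (M.val.presheaf.map (𝟙 (op U))).hom m = _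
  rw [CategoryTheory.Functor.map_id]; rfl

theorem resM_smul (M : S.Modules) {U V : Opens S.space} (h : V ≤ U) (f : S.Fn U) (m : Sec M U) :
    resM M h (f • m) = S.res h f • resM M h m :=
  M.val.map_smul (homOfLE h).op f m

/-- The structure sheaf as a sheaf of modules over itself. -/
abbrev unit (S : AlgSpace K) : S.Modules := SheafOfModules.unit S.ringSheaf

/-- A section `e` over `U` freely generates the module on `U`, that is,
`r ↦ r e` is an isomorphism from the structure sheaf of `U` to the restriction of `M` to `U`. -/
def IsFrame (M : S.Modules) {U : Opens S.space} (e : Sec M U) : Prop :=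
  ∀ (V : Opens S.space) (h : V ≤ U),
    Function.Bijective fun r : S.Fn V => (r • resM M h e : Sec M V)

/-- An invertible sheaf: a sheaf of modules which is locally free of rank one. -/
def IsInvertible (M : S.Modules) : Prop :=
  ∀ x : S.space, ∃ (U : Opens S.space) (e : Sec M U), x ∈ U ∧ IsFrame M e

end AlgSpace

open AlgSpace

/-- A scheme over `Spec k`, viewed as a space with a sheaf of `k`-algebras. -/
def ofScheme {k : Type u} [CommRing k] (X : Scheme.{u}) (π : X ⟶ Spec (.of k)) : AlgSpace k where
  space := X.toTopCat
  sheaf := X.sheaf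
  scalar := ((Scheme.ΓSpecIso (.of k)).inv ≫ π.appTop).hom


/-! ### Poisson structures and Poisson modules -/

section Poisson

variable {K : Type u} [CommRing K]

/-- A sheaf of Poisson `K`-algebra structures on the structure sheaf of `S`. -/
structure PoissonStr (S : AlgSpace K) where
  bracket : ∀ U : Opens S.space, S.Fn U → S.Fn U → S.Fn U
  add_left : ∀ U (f g h : S.Fn U), bracket U (f + g) h = bracket U f h + bracket U g h
  scalar_left : ∀ U (c : K) (f g : S.Fn U),
    bracket U (S.const U c * f) g = S.const U c * bracket U f g
  add_right : ∀ U (f g h : S.Fn U), bracket U f (g + h) = bracket U f g + bracket U f h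
  alternating : ∀ U (f : S.Fn U), bracket U f f = 0
  leibniz : ∀ U (f g h : S.Fn U), bracket U (f * g) h = f * bracket U g h + g * bracket U f h
  jacobi : ∀ U (f g h : S.Fn U),
    bracket U f (bracket U g h) + bracket U g (bracket U h f) + bracket U h (bracket U f g) = 0
  res_bracket : ∀ {U V : Opens S.space} (h : V ≤ U) (f g : S.Fn U),
    S.res h (bracket U f g) = bracket V (S.res h f) (S.res h g)

namespace PoissonStr

variable {S : AlgSpace K} (P : PoissonStr S)

theorem skew (U) (f g : S.Fn U) : P.bracket U f g = -P.bracket U g f := by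
  have h := P.alternating U (f + g)
  rw [P.add_left, P.add_right, P.add_right, P.alternating, P.alternating] at h
  linear_combination h

theorem leibniz_right (U) (f g h : S.Fn U) :
    P.bracket U f (g * h) = P.bracket U f g * h + g * P.bracket U f h := by
  rw [P.skew, P.leibniz, P.skew U g, P.skew U h]; ring

theorem scalar_right (U) (c : K) (f g : S.Fn U) :
    P.bracket U f (S.const U c * g) = S.const U c * P.bracket U f g := by
  rw [P.skew, P.scalar_left, P.skew U g]; ring

end PoissonStr

/-- A flat Poisson connection on a sheaf of modules `M`: a `K`-bilinear bracket of functions with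
sections of `M`, a derivation in the first argument, satisfying the Leibniz identity in the second,
and giving a Lie action of the Poisson Lie algebra of functions. -/
structure FlatConn {S : AlgSpace K} (P : PoissonStr S) (M : S.Modules) where
  bracket : ∀ U : Opens S.space, S.Fn U → Sec M U → Sec M U
  add_left : ∀ U (f g : S.Fn U) (s : Sec M U),
    bracket U (f + g) s = bracket U f s + bracket U g s
  add_right : ∀ U (f : S.Fn U) (s t : Sec M U),
    bracket U f (s + t) = bracket U f s + bracket U f t
  scalar_left : ∀ U (c : K) (f : S.Fn U) (s : Sec M U),
    bracket U (S.const U c * f) s = S.const U c • bracket U f s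
  scalar_right : ∀ U (c : K) (f : S.Fn U) (s : Sec M U),
    bracket U f (S.const U c • s) = S.const U c • bracket U f s
  leibniz_left : ∀ U (f g : S.Fn U) (s : Sec M U),
    bracket U (f * g) s = f • bracket U g s + g • bracket U f s
  leibniz_right : ∀ U (f g : S.Fn U) (s : Sec M U),
    bracket U f (g • s) = P.bracket U f g • s + g • bracket U f s
  flat : ∀ U (f g : S.Fn U) (s : Sec M U),
    bracket U f (bracket U g s) = bracket U (P.bracket U f g) s + bracket U g (bracket U f s)
  res_bracket : ∀ {U V : Opens S.space} (h : V ≤ U) (f : S.Fn U) (s : Sec M U),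
    resM M h (bracket U f s) = bracket V (S.res h f) (resM M h s)

/-- The Poisson bracket as a flat Poisson connection on the structure sheaf. -/
def PoissonStr.toFlatConn {S : AlgSpace K} (P : PoissonStr S) : FlatConn P S.unit where
  bracket := P.bracket
  add_left := P.add_left
  add_right := P.add_right
  scalar_left := P.scalar_left
  scalar_right := P.scalar_right
  leibniz_left := P.leibniz
  leibniz_right := P.leibniz_right
  flat U f g h := by
    change P.bracket U f (P.bracket U g h) = P.bracket U (P.bracket U f g) h +
      P.bracket U g (P.bracket U f h)
    have h1 := P.jacobi U f g h
    have h2 : P.bracket U g (P.bracket U h f) = -P.bracket U g (P.bracket U f h) := by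
      have h3 := P.add_right U g (P.bracket U h f) (P.bracket U f h)
      rw [P.skew U h f, neg_add_cancel] at h3
      have h4 := P.add_right U g 0 0
      rw [add_zero] at h4
      rw [P.skew U h f]
      linear_combination -h3 - h4
    rw [h2, P.skew U h] at h1
    linear_combination h1
  res_bracket := P.res_bracket

/-! ### The complex of a Poisson module -/

variable {S : AlgSpace K}

/-- The open subsets of `U`. -/
abbrev OpensIn {T : TopCat.{u}} (U : Opens T) : Type u := {V : Opens T // V ≤ U}

/-- `K`-derivations of the structure sheaf over `U` with values in `M`, that is, sections over `U`
of `ℋom(Ω¹, M)`: compatible families of derivations on the open subsets of `U`. -/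
def derOn (M : S.Modules) (U : Opens S.space) :
    AddSubgroup (∀ V : OpensIn U, S.Fn V.1 → Sec M V.1) where
  carrier := {D |
    (∀ V (f g : S.Fn V.1), D V (f + g) = D V f + D V g) ∧
    (∀ V (c : K) (f : S.Fn V.1), D V (S.const V.1 c * f) = S.const V.1 c • D V f) ∧
    (∀ V (f g : S.Fn V.1), D V (f * g) = f • D V g + g • D V f) ∧
    (∀ (V W : OpensIn U) (i : W.1 ≤ V.1) (f : S.Fn V.1),
      resM M i (D V f) = D W (S.res i f))}
  zero_mem' := by
    refine ⟨?_, ?_, ?_, ?_⟩ <;> intros <;> simp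
  add_mem' := by
    rintro D E ⟨a1, a2, a3, a4⟩ ⟨b1, b2, b3, b4⟩
    refine ⟨?_, ?_, ?_, ?_⟩ <;> intros <;> simp only [Pi.add_apply, map_add, smul_add]
    · rw [a1, b1]; abel
    · rw [a2, b2]
    · rw [a3, b3]; abel
    · rw [a4, b4]
  neg_mem' := by
    rintro D ⟨a1, a2, a3, a4⟩
    refine ⟨?_, ?_, ?_, ?_⟩ <;> intros <;> simp only [Pi.neg_apply, map_neg, smul_neg]
    · rw [a1]; abel
    · rw [a2]
    · rw [a3]; abel
    · rw [a4]

/-- Alternating biderivations over `K` of the structure sheaf over `U` with values in `M`, that is,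
sections over `U` of `ℋom(⋀²Ω¹, M)`. -/
def biderOn (M : S.Modules) (U : Opens S.space) :
    AddSubgroup (∀ V : OpensIn U, S.Fn V.1 → S.Fn V.1 → Sec M V.1) where
  carrier := {B |
    (∀ V (f g k : S.Fn V.1), B V (f + g) k = B V f k + B V g k) ∧
    (∀ V (c : K) (f g : S.Fn V.1), B V (S.const V.1 c * f) g = S.const V.1 c • B V f g) ∧
    (∀ V (f g k : S.Fn V.1), B V (f * g) k = f • B V g k + g • B V f k) ∧
    (∀ V (f : S.Fn V.1), B V f f = 0) ∧
    (∀ (V W : OpensIn U) (i : W.1 ≤ V.1) (f g : S.Fn V.1),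
      resM M i (B V f g) = B W (S.res i f) (S.res i g))}
  zero_mem' := by
    refine ⟨?_, ?_, ?_, ?_, ?_⟩ <;> intros <;> simp
  add_mem' := by
    rintro D E ⟨a1, a2, a3, a5, a4⟩ ⟨b1, b2, b3, b5, b4⟩
    refine ⟨?_, ?_, ?_, ?_, ?_⟩ <;> intros <;> simp only [Pi.add_apply, map_add, smul_add]
    · rw [a1, b1]; abel
    · rw [a2, b2]
    · rw [a3, b3]; abel
    · rw [a5, b5]; abel
    · rw [a4, b4]
  neg_mem' := by
    rintro D ⟨a1, a2, a3, a5, a4⟩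
    refine ⟨?_, ?_, ?_, ?_, ?_⟩ <;> intros <;> simp only [Pi.neg_apply, map_neg, smul_neg]
    · rw [a1]; abel
    · rw [a2]
    · rw [a3]; abel
    · rw [a5, neg_zero]
    · rw [a4]

/-- The presheaf (in fact sheaf) `ℋom(Ω¹, M)`. -/
def derPresheaf (M : S.Modules) : TopCat.Presheaf AddCommGrpCat.{u} S.space where
  obj U := .of (derOn M U.unop)
  map {U V} i := AddCommGrpCat.ofHom
    { toFun := fun D => ⟨fun W => D.1 ⟨W.1, W.2.trans i.unop.le⟩,
        fun _ => D.2.1 ⟨_, _⟩, fun _ => D.2.2.1 ⟨_, _⟩, fun _ => D.2.2.2.1 ⟨_, _⟩,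
        fun _ _ h => D.2.2.2.2 ⟨_, _⟩ ⟨_, _⟩ h⟩
      map_zero' := rfl
      map_add' := fun _ _ => rfl }

/-- The presheaf (in fact sheaf) `ℋom(⋀²Ω¹, M)`. -/
def biderPresheaf (M : S.Modules) : TopCat.Presheaf AddCommGrpCat.{u} S.space where
  obj U := .of (biderOn M U.unop)
  map {U V} i := AddCommGrpCat.ofHom
    { toFun := fun B => ⟨fun W => B.1 ⟨W.1, W.2.trans i.unop.le⟩,
        fun _ => B.2.1 ⟨_, _⟩, fun _ => B.2.2.1 ⟨_, _⟩, fun _ => B.2.2.2.1 ⟨_, _⟩,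
        fun _ => B.2.2.2.2.1 ⟨_, _⟩,
        fun _ _ h => B.2.2.2.2.2 ⟨_, _⟩ ⟨_, _⟩ h⟩
      map_zero' := rfl
      map_add' := fun _ _ => rfl }

namespace FlatConn

variable {P : PoissonStr S} {M : S.Modules} (C : FlatConn P M)

theorem bracket_zero (U) (f : S.Fn U) : C.bracket U f 0 = 0 := by
  have h := C.add_right U f 0 0
  rw [add_zero] at h
  exact left_eq_add.mp h

/-- `v₀(s)(f) = {f, s}` -/
def v0 (U : Opens S.space) : Sec M U →+ derOn M U where
  toFun s := ⟨fun V f => C.bracket V.1 f (resM M V.2 s),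
    fun V f g => C.add_left V.1 f g _,
    fun V c f => C.scalar_left V.1 c f _,
    fun V f g => C.leibniz_left V.1 f g _,
    fun V W i f => by
      change resM M i (C.bracket V.1 f (resM M V.2 s)) = C.bracket W.1 (S.res i f) (resM M W.2 s)
      rw [C.res_bracket, resM_resM]⟩
  map_zero' := by
    refine Subtype.ext ?_
    funext V f
    change C.bracket V.1 f (resM M V.2 0) = 0
    rw [map_zero, C.bracket_zero]
  map_add' s t := by
    refine Subtype.ext ?_
    funext V f
    change C.bracket V.1 f (resM M V.2 (s + t)) = _
    rw [map_add, C.add_right]; rfl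

/-- `v₁(δ)(f, g) = {f, δ(g)} - {g, δ(f)} - δ({f, g})` -/
def v1 (U : Opens S.space) : derOn M U →+ biderOn M U where
  toFun D := ⟨fun V f g => C.bracket V.1 f (D.1 V g) - C.bracket V.1 g (D.1 V f)
      - D.1 V (P.bracket V.1 f g), by
    obtain ⟨D, a1, a2, a3, a4⟩ := D
    have hz : ∀ V, D V 0 = 0 := fun V => by
      have h := a1 V 0 0
      rw [add_zero] at h
      exact left_eq_add.mp h
    refine ⟨?_, ?_, ?_, ?_, ?_⟩
    · intro V f g k
      simp only [C.add_left, a1, C.add_right, P.add_left]; abel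
    · intro V c f g
      simp only [C.scalar_left, a2, C.scalar_right, P.scalar_left, smul_sub]
    · intro V f g k
      simp only [C.leibniz_left, a3, C.add_right, C.leibniz_right, P.leibniz, a1, smul_sub]
      rw [P.skew V.1 k f, P.skew V.1 k g]
      simp only [neg_smul]; abel
    · intro V f
      simp only [P.alternating, hz]; abel
    · intro V W i f g
      simp only [map_sub, C.res_bracket, a4 V W i, P.res_bracket]⟩
  map_zero' := by
    refine Subtype.ext ?_
    funext V f g
    change C.bracket V.1 f 0 - C.bracket V.1 g 0 - 0 = 0
    rw [C.bracket_zero, C.bracket_zero]; abel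
  map_add' D E := by
    refine Subtype.ext ?_
    funext V f g
    change C.bracket V.1 f (D.1 V g + E.1 V g) - C.bracket V.1 g (D.1 V f + E.1 V f) -
      (D.1 V _ + E.1 V _) = (_ - _ - _) + (_ - _ - _)
    rw [C.add_right, C.add_right]; abel

/-- The complex `M → T ⊗ M → ⋀²T ⊗ M` of a flat Poisson connection, in degrees `0, 1, 2`. -/
def complex : ShortComplex (TopCat.Presheaf AddCommGrpCat.{u} S.space) where
  X₁ := M.val.presheaf
  X₂ := derPresheaf M
  X₃ := biderPresheaf M
  f :=
    { app := fun U => AddCommGrpCat.ofHom (C.v0 U.unop)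
      naturality := by
        intro U V i
        ext s
        refine Subtype.ext ?_
        funext W f
        exact congrArg (C.bracket W.1 f) (resM_resM M i.unop.le W.2 s) }
  g :=
    { app := fun U => AddCommGrpCat.ofHom (C.v1 U.unop)
      naturality := fun _ _ _ => rfl }
  zero := by
    ext U s
    refine Subtype.ext ?_
    funext V f g
    change C.bracket V.1 f (C.bracket V.1 g _) - C.bracket V.1 g (C.bracket V.1 f _)
      - C.bracket V.1 (P.bracket V.1 f g) _ = 0
    rw [C.flat]; abel

end FlatConn

end Poisson

/-! ### Čech hypercohomology in degrees `0` and `1` -/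

section Cech

variable {T : TopCat.{u}}

/-- Restriction in a presheaf of abelian groups. -/
def rs (F : TopCat.Presheaf AddCommGrpCat.{u} T) {U V : Opens T} (h : V ≤ U) :
    F.obj (op U) →+ F.obj (op V) :=
  (F.map (homOfLE h).op).hom

theorem rs_rs (F : TopCat.Presheaf AddCommGrpCat.{u} T) {U V W : Opens T} (h : V ≤ U) (h' : W ≤ V)
    (s : F.obj (op U)) : rs F h' (rs F h s) = rs F (h'.trans h) s := by
  change (F.map (homOfLE h).op ≫ F.map (homOfLE h').op).hom s = _
  rw [← Functor.map_comp]; rfl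

theorem rs_self (F : TopCat.Presheaf AddCommGrpCat.{u} T) {U : Opens T} (s : F.obj (op U)) :
    rs F le_rfl s = s := by
  change (F.map (𝟙 (op U))).hom s = _
  rw [CategoryTheory.Functor.map_id]; rfl

/-- A morphism of presheaves on sections. -/
def ap {F G : TopCat.Presheaf AddCommGrpCat.{u} T} (φ : F ⟶ G) (U : Opens T) :
    F.obj (op U) →+ G.obj (op U) :=
  (φ.app (op U)).hom

theorem ap_rs {F G : TopCat.Presheaf AddCommGrpCat.{u} T} (φ : F ⟶ G) {U V : Opens T} (h : V ≤ U)
    (s : F.obj (op U)) : ap φ V (rs F h s) = rs G h (ap φ U s) :=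
  ConcreteCategory.congr_hom (φ.naturality (homOfLE h).op) s

theorem ap_comp {F G H : TopCat.Presheaf AddCommGrpCat.{u} T} (φ : F ⟶ G) (ψ : G ⟶ H)
    (U : Opens T) (s : F.obj (op U)) : ap (φ ≫ ψ) U s = ap ψ U (ap φ U s) := rfl

/-- An open cover indexed by the points: `nbhd x` is an open neighbourhood of `x`. -/
structure PtCover (T : TopCat.{u}) where
  nbhd : T → Opens T
  mem : ∀ x, x ∈ nbhd x

/-- `𝒰 ≤ 𝒱` when `𝒱` refines `𝒰`. Every open cover is refined by one indexed by the points. -/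
instance : Preorder (PtCover T) where
  le 𝒰 𝒱 := ∀ x, 𝒱.nbhd x ≤ 𝒰.nbhd x
  le_refl _ _ := le_rfl
  le_trans _ _ _ h h' x := (h' x).trans (h x)

instance : Nonempty (PtCover T) := ⟨⟨fun _ => ⊤, fun _ => trivial⟩⟩

instance : IsDirectedOrder (PtCover T) where
  directed 𝒰 𝒱 := ⟨⟨fun x => 𝒰.nbhd x ⊓ 𝒱.nbhd x, fun x => ⟨𝒰.mem x, 𝒱.mem x⟩⟩,
    fun _ => inf_le_left, fun _ => inf_le_right⟩

variable (C : ShortComplex (TopCat.Presheaf AddCommGrpCat.{u} T))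

/-- The hypercohomology of `C` in degree `0`, where `C` is regarded as the beginning, in degrees
`0, 1, 2`, of a complex of sheaves in degrees `≥ 0`: the global sections with differential zero. -/
def H0 : AddSubgroup (C.X₁.obj (op ⊤)) := (ap C.f ⊤).ker

variable (𝒰 : PtCover T)

/-- Total Čech cochains of degree `0`. -/
abbrev C0 : Type u := ∀ x, C.X₁.obj (op (𝒰.nbhd x))

/-- Total Čech cochains of degree `1`. -/
abbrev C1 : Type u :=
  (∀ x y, C.X₁.obj (op (𝒰.nbhd x ⊓ 𝒰.nbhd y))) × (∀ x, C.X₂.obj (op (𝒰.nbhd x)))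

/-- Total Čech cochains of degree `2`. -/
abbrev C2 : Type u :=
  (∀ x y z, C.X₁.obj (op (𝒰.nbhd x ⊓ 𝒰.nbhd y ⊓ 𝒰.nbhd z))) ×
    (∀ x y, C.X₂.obj (op (𝒰.nbhd x ⊓ 𝒰.nbhd y))) × (∀ x, C.X₃.obj (op (𝒰.nbhd x)))

/-- The total differential in degree `0`: `t ↦ (δt, dt)`. -/
def d0 : C0 C 𝒰 →+ C1 C 𝒰 where
  toFun t := (fun x y => rs C.X₁ inf_le_right (t y) - rs C.X₁ inf_le_left (t x),
    fun x => ap C.f _ (t x))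
  map_zero' := by
    ext <;> simp
  map_add' s t := by
    ext <;> simp; abel

/-- The total differential in degree `1`: `(a, w) ↦ (δa, da - δw, dw)`. -/
def d1 : C1 C 𝒰 →+ C2 C 𝒰 where
  toFun c :=
    (fun x y z => rs C.X₁ (inf_le_inf_right _ inf_le_right) (c.1 y z)
        - rs C.X₁ (inf_le_inf_right _ inf_le_left) (c.1 x z)
        + rs C.X₁ inf_le_left (c.1 x y),
      fun x y => ap C.f _ (c.1 x y) - (rs C.X₂ inf_le_right (c.2 y) - rs C.X₂ inf_le_left (c.2 x)),
      fun x => ap C.g _ (c.2 x))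
  map_zero' := by
    ext <;> simp
  map_add' s t := by
    ext <;> simp <;> abel

/-- Total Čech cocycles of degree `1`. -/
abbrev Z1 : AddSubgroup (C1 C 𝒰) := (d1 C 𝒰).ker

/-- Total Čech coboundaries of degree `1`, as a subgroup of the cocycles. -/
abbrev B1 : AddSubgroup (Z1 C 𝒰) := (d0 C 𝒰).range.addSubgroupOf (Z1 C 𝒰)

/-- The Čech hypercohomology of the cover `𝒰` in degree `1`. -/
abbrev CechH1 : Type u := Z1 C 𝒰 ⧸ B1 C 𝒰

variable {𝒰} {𝒱 : PtCover T}

/-- Restriction of cocycles to a refinement. -/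
def refineZ (h : 𝒰 ≤ 𝒱) : Z1 C 𝒰 →+ Z1 C 𝒱 where
  toFun c := ⟨(fun x y => rs C.X₁ (inf_le_inf (h x) (h y)) (c.1.1 x y),
    fun x => rs C.X₂ (h x) (c.1.2 x)), by
      have hc := c.2
      rw [AddMonoidHom.mem_ker] at hc ⊢
      refine Prod.ext ?_ (Prod.ext ?_ ?_)
      · funext x y z
        have := congrArg (rs C.X₁ (inf_le_inf (inf_le_inf (h x) (h y)) (h z)))
          (congrFun (congrFun (congrFun (congrArg Prod.fst hc) x) y) z)
        simpa [d1, rs_rs] using this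
      · funext x y
        have := congrArg (rs C.X₂ (inf_le_inf (h x) (h y)))
          (congrFun (congrFun (congrArg (fun c => c.2.1) hc) x) y)
        simpa [d1, rs_rs, ap_rs] using this
      · funext x
        have := congrArg (rs C.X₃ (h x)) (congrFun (congrArg (fun c => c.2.2) hc) x)
        simpa [d1, rs_rs, ap_rs] using this⟩
  map_zero' := by
    refine Subtype.ext (Prod.ext ?_ ?_) <;> ext <;> simp
  map_add' c d := by
    refine Subtype.ext (Prod.ext ?_ ?_) <;> ext <;> simp

/-- Restriction of Čech classes to a refinement. -/
def refine (h : 𝒰 ≤ 𝒱) : CechH1 C 𝒰 →+ CechH1 C 𝒱 :=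
  QuotientAddGroup.map _ _ (refineZ C h) (by
    rintro ⟨c, hc⟩ ⟨t, rfl⟩
    refine ⟨fun x => rs C.X₁ (h x) (t x), ?_⟩
    refine Prod.ext ?_ ?_
    · funext x y
      simp [d0, refineZ, rs_rs]
    · funext x
      simp [d0, refineZ, ap_rs])

open Classical in
/-- The hypercohomology of `C` in degree `1`, where `C` is regarded as the beginning, in degrees
`0, 1, 2`, of a complex of sheaves in degrees `≥ 0`: the direct limit over all open covers of the
first cohomology of the total Čech complex. -/
def H1 : Type u :=
  AddCommGroup.DirectLimit (CechH1 C) (fun _ _ h => refine C h)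

open Classical in
instance : AddCommGroup (H1 C) :=
  inferInstanceAs (AddCommGroup (AddCommGroup.DirectLimit (CechH1 C) (fun _ _ h => refine C h)))

open Classical in
/-- The class of a Čech cocycle. -/
def cls (𝒰 : PtCover T) : Z1 C 𝒰 →+ H1 C :=
  (AddCommGroup.DirectLimit.of (CechH1 C) (fun _ _ h => refine C h) 𝒰).comp
    (QuotientAddGroup.mk' _)

variable {C} {D : ShortComplex (TopCat.Presheaf AddCommGrpCat.{u} T)} (φ : C ⟶ D)

/-- The map on cocycles induced by a morphism of complexes. -/
def mapZ (𝒰 : PtCover T) : Z1 C 𝒰 →+ Z1 D 𝒰 where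
  toFun c := ⟨(fun x y => ap φ.τ₁ _ (c.1.1 x y), fun x => ap φ.τ₂ _ (c.1.2 x)), by
      have hc := c.2
      have e1 : ∀ U s, ap D.f U (ap φ.τ₁ U s) = ap φ.τ₂ U (ap C.f U s) := fun U s => by
        rw [← ap_comp, ← ap_comp, φ.comm₁₂]
      have e2 : ∀ U s, ap D.g U (ap φ.τ₂ U s) = ap φ.τ₃ U (ap C.g U s) := fun U s => by
        rw [← ap_comp, ← ap_comp, φ.comm₂₃]
      rw [AddMonoidHom.mem_ker] at hc ⊢
      refine Prod.ext ?_ (Prod.ext ?_ ?_)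
      · funext x y z
        have := congrArg (ap φ.τ₁ _) (congrFun (congrFun (congrFun (congrArg Prod.fst hc) x) y) z)
        simpa [d1, ap_rs] using this
      · funext x y
        have := congrArg (ap φ.τ₂ _) (congrFun (congrFun (congrArg (fun c => c.2.1) hc) x) y)
        simpa [d1, ap_rs, e1] using this
      · funext x
        have := congrArg (ap φ.τ₃ _) (congrFun (congrArg (fun c => c.2.2) hc) x)
        simpa [d1, e2] using this⟩
  map_zero' := by
    refine Subtype.ext (Prod.ext ?_ ?_) <;> ext <;> simp
  map_add' c d := by
    refine Subtype.ext (Prod.ext ?_ ?_) <;> ext <;> simp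

/-- The map on the Čech hypercohomology of a cover induced by a morphism of complexes. -/
def mapCechH1 (𝒰 : PtCover T) : CechH1 C 𝒰 →+ CechH1 D 𝒰 :=
  QuotientAddGroup.map _ _ (mapZ φ 𝒰) (by
    rintro ⟨c, hc⟩ ⟨t, rfl⟩
    refine ⟨fun x => ap φ.τ₁ _ (t x), ?_⟩
    refine Prod.ext ?_ ?_
    · funext x y
      simp [d0, mapZ, ap_rs]
    · funext x
      simp only [d0, mapZ, AddMonoidHom.coe_mk, ZeroHom.coe_mk]
      change ap D.f _ (ap φ.τ₁ _ _) = ap φ.τ₂ _ (ap C.f _ _)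
      rw [← ap_comp, ← ap_comp, φ.comm₁₂])

open Classical in
/-- The map on hypercohomology in degree `1` induced by a morphism of complexes. -/
def mapH1 : H1 C →+ H1 D :=
  AddCommGroup.DirectLimit.map (mapCechH1 φ) (by
    intro 𝒰 𝒱 h
    ext c
    refine congrArg (QuotientAddGroup.mk (s := B1 D 𝒱)) (Subtype.ext (Prod.ext ?_ ?_))
    · funext x y
      exact ap_rs φ.τ₁ _ _
    · funext x
      exact ap_rs φ.τ₂ _ _)

theorem mapH1_cls (𝒰 : PtCover T) (c : Z1 C 𝒰) :
    mapH1 φ (cls C 𝒰 c) = cls D 𝒰 (mapZ φ 𝒰 c) := by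
  classical
  exact AddCommGroup.DirectLimit.map_apply_of _ _ _

theorem H1_induction {p : H1 C → Prop} (a : H1 C) (h : ∀ 𝒰 c, p (cls C 𝒰 c)) : p a := by
  classical
  refine AddCommGroup.DirectLimit.induction_on a fun 𝒰 x => ?_
  obtain ⟨c, rfl⟩ := QuotientAddGroup.mk_surjective x
  exact h 𝒰 c

end Cech

/-! ### Multiplication by a Poisson section -/

section Mult

variable {K : Type u} [CommRing K] {S : AlgSpace K} {P : PoissonStr S} {M : S.Modules}

/-- A section of the structure sheaf as a function. -/
def asFn {U : Opens S.space} : Sec S.unit U →+ S.Fn U := AddMonoidHom.id (S.Fn U)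

theorem asFn_smul {U : Opens S.space} (f : S.Fn U) (r : Sec S.unit U) :
    asFn (f • r) = f * asFn r := rfl

theorem asFn_resM {U V : Opens S.space} (h : V ≤ U) (r : Sec S.unit U) :
    asFn (resM S.unit h r) = S.res h (asFn r) := rfl

/-- A section of the zeroth term of the complex of `M` as a section of `M`. -/
def FlatConn.sec (C : FlatConn P M) (s : H0 C.complex) : Sec M ⊤ := s.1

theorem FlatConn.bracket_sec (C : FlatConn P M) (s : H0 C.complex) (V : Opens S.space)
    (f : S.Fn V) : C.bracket V f (resM M le_top (C.sec s)) = 0 :=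
  congrFun (congrFun (congrArg Subtype.val s.2) ⟨V, le_top⟩) f

theorem FlatConn.sec_add (C : FlatConn P M) (s t : H0 C.complex) :
    C.sec (s + t) = C.sec s + C.sec t := rfl

/-- Multiplication of functions with a global section: `f ↦ f ⊗ s`. -/
def mul0 (s : Sec M ⊤) (U : Opens S.space) : Sec S.unit U →+ Sec M U where
  toFun f := asFn f • resM M le_top s
  map_zero' := by rw [map_zero, zero_smul]
  map_add' f g := by rw [map_add, add_smul]

/-- Multiplication of vector fields with a global section: `D ↦ D ⊗ s`. -/
def mul1 (s : Sec M ⊤) (U : Opens S.space) : derOn S.unit U →+ derOn M U where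
  toFun D := ⟨fun V f => asFn (D.1 V f) • resM M le_top s, by
    obtain ⟨D, a1, a2, a3, a4⟩ := D
    refine ⟨?_, ?_, ?_, ?_⟩
    · intro V f g
      simp only [a1, map_add, add_smul]
    · intro V c f
      simp only [a2, asFn_smul, mul_smul]
    · intro V f g
      simp only [a3, map_add, asFn_smul, add_smul, mul_smul]
    · intro V W i f
      simp only [resM_smul, ← asFn_resM, a4 V W i, resM_resM]⟩
  map_zero' := by
    refine Subtype.ext ?_
    funext V f
    exact zero_smul _ _
  map_add' D E := by
    refine Subtype.ext ?_
    funext V f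
    exact add_smul _ _ _

/-- Multiplication of bivector fields with a global section: `B ↦ B ⊗ s`. -/
def mul2 (s : Sec M ⊤) (U : Opens S.space) : biderOn S.unit U →+ biderOn M U where
  toFun B := ⟨fun V f g => asFn (B.1 V f g) • resM M le_top s, by
    obtain ⟨B, a1, a2, a3, a4, a5⟩ := B
    refine ⟨?_, ?_, ?_, ?_, ?_⟩
    · intro V f g k
      simp only [a1, map_add, add_smul]
    · intro V c f g
      simp only [a2, asFn_smul, mul_smul]
    · intro V f g k
      simp only [a3, map_add, asFn_smul, add_smul, mul_smul]
    · intro V f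
      simp only [a4, map_zero, zero_smul]
    · intro V W i f g
      simp only [resM_smul, ← asFn_resM, a5 V W i, resM_resM]⟩
  map_zero' := by
    refine Subtype.ext ?_
    funext V f g
    exact zero_smul _ _
  map_add' D E := by
    refine Subtype.ext ?_
    funext V f g
    exact add_smul _ _ _

theorem v1_mul1 (C : FlatConn P M) (s : H0 C.complex) (U : Opens S.space) (D : derOn S.unit U) :
    C.v1 U (mul1 (C.sec s) U D) = mul2 (C.sec s) U (P.toFlatConn.v1 U D) := by
  refine Subtype.ext ?_
  funext V f g
  change C.bracket V.1 f (asFn (D.1 V g) • resM M le_top (C.sec s)) -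
      C.bracket V.1 g (asFn (D.1 V f) • resM M le_top (C.sec s)) -
      asFn (D.1 V (P.bracket V.1 f g)) • resM M le_top (C.sec s) =
    (P.bracket V.1 f (asFn (D.1 V g)) - P.bracket V.1 g (asFn (D.1 V f)) -
      asFn (D.1 V (P.bracket V.1 f g))) • resM M le_top (C.sec s)
  rw [C.leibniz_right, C.leibniz_right, C.bracket_sec, C.bracket_sec, smul_zero, smul_zero,
    add_zero, add_zero, sub_smul, sub_smul]

theorem mul0_zero (U : Opens S.space) (f : Sec S.unit U) : mul0 (0 : Sec M ⊤) U f = 0 := by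
  change asFn f • resM M (le_top : U ≤ ⊤) 0 = 0
  rw [map_zero, smul_zero]

theorem mul0_add (s t : Sec M ⊤) (U : Opens S.space) (f : Sec S.unit U) :
    mul0 (s + t) U f = mul0 s U f + mul0 t U f := by
  change asFn f • resM M (le_top : U ≤ ⊤) (s + t) =
    asFn f • resM M (le_top : U ≤ ⊤) s + asFn f • resM M (le_top : U ≤ ⊤) t
  rw [map_add, smul_add]

theorem mul1_zero (U : Opens S.space) (D : derOn S.unit U) : mul1 (0 : Sec M ⊤) U D = 0 :=
  Subtype.ext (funext fun V => funext fun f => mul0_zero V.1 (D.1 V f))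

theorem mul1_add (s t : Sec M ⊤) (U : Opens S.space) (D : derOn S.unit U) :
    mul1 (s + t) U D = mul1 s U D + mul1 t U D :=
  Subtype.ext (funext fun V => funext fun f => mul0_add s t V.1 (D.1 V f))

/-- Multiplication with a Poisson section `s`, as a morphism of complexes from
`𝒪 → T → ⋀²T` to `M → T ⊗ M → ⋀²T ⊗ M`. -/
def mulComplex (C : FlatConn P M) (s : H0 C.complex) :
    P.toFlatConn.complex ⟶ C.complex where
  τ₁ :=
    { app := fun U => AddCommGrpCat.ofHom (mul0 (C.sec s) U.unop)
      naturality := by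
        intro U V i
        ext f
        change S.res i.unop.le (asFn f) • resM M le_top (C.sec s) =
          resM M i.unop.le (asFn f • resM M le_top (C.sec s))
        rw [resM_smul, resM_resM] }
  τ₂ :=
    { app := fun U => AddCommGrpCat.ofHom (mul1 (C.sec s) U.unop)
      naturality := fun _ _ _ => rfl }
  τ₃ :=
    { app := fun U => AddCommGrpCat.ofHom (mul2 (C.sec s) U.unop)
      naturality := fun _ _ _ => rfl }
  comm₁₂ := by
    ext U f
    refine Subtype.ext ?_
    funext V g
    change C.bracket V.1 g (resM M V.2 (asFn f • resM M le_top (C.sec s))) =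
      P.bracket V.1 g (S.res V.2 (asFn f)) • resM M le_top (C.sec s)
    rw [resM_smul, resM_resM, C.leibniz_right, C.bracket_sec, smul_zero, add_zero]
  comm₂₃ := by
    ext U D
    exact v1_mul1 C s U D

/-- The map `m₁ : ℍ¹(𝒪) → Hom(ℍ⁰(M), ℍ¹(M))` induced by `a ↦ (s ↦ a ⊗ s)`. -/
def m1 (C : FlatConn P M) : H1 P.toFlatConn.complex →+ (H0 C.complex →+ H1 C.complex) :=
  AddMonoidHom.flip
    { toFun := fun s => mapH1 (mulComplex C s)
      map_zero' := by
        refine AddMonoidHom.ext fun a => H1_induction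
          (p := fun a => mapH1 (mulComplex C 0) a = 0) a fun 𝒰 c => ?_
        rw [mapH1_cls]
        refine (congrArg (cls C.complex 𝒰) (Subtype.ext (Prod.ext ?_ ?_))).trans (map_zero _)
        · exact funext fun x => funext fun y => mul0_zero _ _
        · exact funext fun x => mul1_zero _ _
      map_add' := fun s t => by
        refine AddMonoidHom.ext fun a => H1_induction
          (p := fun a => mapH1 (mulComplex C (s + t)) a =
            mapH1 (mulComplex C s) a + mapH1 (mulComplex C t) a) a fun 𝒰 c => ?_
        rw [mapH1_cls, mapH1_cls, mapH1_cls, ← map_add]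
        refine congrArg (cls C.complex 𝒰) (Subtype.ext (Prod.ext ?_ ?_))
        · exact funext fun x => funext fun y => mul0_add _ _ _ _
        · exact funext fun x => mul1_add _ _ _ _ }

end Mult

/-! ### The trivial first-order thickening -/

section Thick

/-- The homomorphism of dual numbers induced by a ring homomorphism. -/
def dualMap {A B : Type u} [CommRing A] [CommRing B] (φ : A →+* B) :
    DualNumber A →+* DualNumber B where
  toFun x := (φ x.fst, φ x.snd)
  map_one' := TrivSqZeroExt.ext (map_one φ) (map_zero φ)
  map_zero' := TrivSqZeroExt.ext (map_zero φ) (map_zero φ)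
  map_add' x y := TrivSqZeroExt.ext (map_add φ _ _) (map_add φ _ _)
  map_mul' x y := TrivSqZeroExt.ext (map_mul φ _ _) (by
    change φ (x.fst * y.snd + x.snd * y.fst) = φ x.fst * φ y.snd + φ x.snd * φ y.fst
    rw [map_add, map_mul, map_mul])

/-- The presheaf of dual numbers `U ↦ F(U)[ε]`. -/
def dualPresheaf {T : TopCat.{u}} (F : TopCat.Presheaf CommRingCat.{u} T) :
    TopCat.Presheaf CommRingCat.{u} T where
  obj U := .of (DualNumber (F.obj U))
  map i := CommRingCat.ofHom (dualMap (F.map i).hom)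
  map_id U := by
    refine CommRingCat.hom_ext (RingHom.ext fun x => TrivSqZeroExt.ext ?_ ?_)
    · exact congrArg (fun φ => φ.hom x.fst) (F.map_id U)
    · exact congrArg (fun φ => φ.hom x.snd) (F.map_id U)
  map_comp i j := by
    refine CommRingCat.hom_ext (RingHom.ext fun x => TrivSqZeroExt.ext ?_ ?_)
    · exact congrArg (fun φ => φ.hom x.fst) (F.map_comp i j)
    · exact congrArg (fun φ => φ.hom x.snd) (F.map_comp i j)

theorem dualPresheaf_isSheaf {T : TopCat.{u}} (F : TopCat.Presheaf CommRingCat.{u} T)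
    (hF : F.IsSheaf) : (dualPresheaf F).IsSheaf := by
  rw [TopCat.Presheaf.isSheaf_iff_isSheafUniqueGluing] at hF ⊢
  intro ι U sf h
  obtain ⟨a, ha, ha'⟩ := hF U (fun i => (sf i : DualNumber _).fst)
    (fun i j => congrArg TrivSqZeroExt.fst (h i j))
  obtain ⟨b, hb, hb'⟩ := hF U (fun i => (sf i : DualNumber _).snd)
    (fun i j => congrArg TrivSqZeroExt.snd (h i j))
  refine ⟨((a, b) : DualNumber _), fun i => TrivSqZeroExt.ext (ha i) (hb i), fun c hc => ?_⟩
  exact TrivSqZeroExt.ext (ha' _ fun i => congrArg TrivSqZeroExt.fst (hc i))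
    (hb' _ fun i => congrArg TrivSqZeroExt.snd (hc i))

variable {k : Type u} [CommRing k]

/-- The product of `S` with `Spec k[ε]`: the same topological space with the sheaf `𝒪_S ⊗ k[ε]`,
that is, `U ↦ 𝒪_S(U)[ε]`, as a sheaf of `k[ε]`-algebras. -/
abbrev AlgSpace.thick (S : AlgSpace k) : AlgSpace (DualNumber k) where
  space := S.space
  sheaf := ⟨dualPresheaf S.sheaf.presheaf, dualPresheaf_isSheaf _ S.sheaf.property⟩
  scalar := dualMap S.scalar

variable {S : AlgSpace k}

/-- Functions on the thickening are dual numbers over functions on `S`. -/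
def AlgSpace.toDual (U : Opens S.space) : S.thick.Fn U ≃+* DualNumber (S.Fn U) :=
  RingEquiv.refl (DualNumber (S.Fn U))

/-- The function `a + ε b`. -/
def AlgSpace.dual {U : Opens S.space} (a b : S.Fn U) : S.thick.Fn U :=
  (AlgSpace.toDual U).symm (a, b)

/-- The coefficient `a` of `a + ε b`. -/
def AlgSpace.re {U : Opens S.space} : S.thick.Fn U →+* S.Fn U :=
  (TrivSqZeroExt.fstHom (S.Fn U) (S.Fn U) (S.Fn U)).toRingHom.comp
    (AlgSpace.toDual U).toRingHom

/-- The coefficient `b` of `a + ε b`. -/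
def AlgSpace.im {U : Opens S.space} (f : S.thick.Fn U) : S.Fn U :=
  (AlgSpace.toDual U f).snd

theorem AlgSpace.dual_ext {U : Opens S.space} {f g : S.thick.Fn U} (h : re f = re g)
    (h' : im f = im g) : f = g := TrivSqZeroExt.ext h h'

theorem AlgSpace.im_mul {U : Opens S.space} (f g : S.thick.Fn U) :
    im (f * g) = re f * im g + im f * re g := rfl

/-- The trivial Poisson deformation: the `k[ε]`-bilinear extension of the Poisson bracket. -/
def PoissonStr.thick (P : PoissonStr S) : PoissonStr S.thick where
  bracket U f g := AlgSpace.dual (P.bracket U (re f) (re g))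
    (P.bracket U (re f) (im g) + P.bracket U (im f) (re g))
  add_left U f g h := by
    refine AlgSpace.dual_ext (P.add_left U _ _ _) ?_
    change P.bracket U (re f + re g) (im h) + P.bracket U (im f + im g) (re h) =
      (_ + _) + (_ + _)
    rw [P.add_left, P.add_left]; ring
  add_right U f g h := by
    refine AlgSpace.dual_ext (P.add_right U _ _ _) ?_
    change P.bracket U (re f) (im g + im h) + P.bracket U (im f) (re g + re h) =
      (_ + _) + (_ + _)
    rw [P.add_right, P.add_right]; ring
  scalar_left U c f g := by
    refine AlgSpace.dual_ext (P.scalar_left U _ _ _) ?_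
    change P.bracket U (S.const U c.fst * re f) (im g) +
        P.bracket U (S.const U c.fst * im f + S.const U c.snd * re f) (re g) =
      S.const U c.fst * (P.bracket U (re f) (im g) + P.bracket U (im f) (re g)) +
        S.const U c.snd * P.bracket U (re f) (re g)
    rw [P.add_left]
    simp only [P.scalar_left]; ring
  alternating U f := by
    refine AlgSpace.dual_ext (P.alternating U _) ?_
    change P.bracket U (re f) (im f) + P.bracket U (im f) (re f) = 0
    rw [P.skew]; ring
  leibniz U f g h := by
    refine AlgSpace.dual_ext (P.leibniz U _ _ _) ?_
    change P.bracket U (re f * re g) (im h) + P.bracket U (re f * im g + im f * re g) (re h) =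
      (re f * (P.bracket U (re g) (im h) + P.bracket U (im g) (re h)) +
        im f * P.bracket U (re g) (re h)) +
      (re g * (P.bracket U (re f) (im h) + P.bracket U (im f) (re h)) +
        im g * P.bracket U (re f) (re h))
    rw [P.add_left]
    simp only [P.leibniz]; ring
  jacobi U f g h := by
    refine AlgSpace.dual_ext (P.jacobi U _ _ _) ?_
    have h1 := P.jacobi U (im f) (re g) (re h)
    have h2 := P.jacobi U (re f) (im g) (re h)
    have h3 := P.jacobi U (re f) (re g) (im h)
    change (P.bracket U (re f) (P.bracket U (re g) (im h) + P.bracket U (im g) (re h)) +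
        P.bracket U (im f) (P.bracket U (re g) (re h))) +
      (P.bracket U (re g) (P.bracket U (re h) (im f) + P.bracket U (im h) (re f)) +
        P.bracket U (im g) (P.bracket U (re h) (re f))) +
      (P.bracket U (re h) (P.bracket U (re f) (im g) + P.bracket U (im f) (re g)) +
        P.bracket U (im h) (P.bracket U (re f) (re g))) = 0
    simp only [P.add_right]
    linear_combination h1 + h2 + h3
  res_bracket {U V} h f g := by
    refine AlgSpace.dual_ext (P.res_bracket h _ _) ?_
    change S.res h (P.bracket U (re f) (im g) + P.bracket U (im f) (re g)) =
      P.bracket V (S.res h (re f)) (S.res h (im g)) + P.bracket V (S.res h (im f)) (S.res h (re g))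
    rw [map_add, P.res_bracket, P.res_bracket]

end Thick

/-! ### First-order deformations of a Poisson invertible sheaf and extension of sections -/

section Deformation

variable {k : Type u} [CommRing k] {S : AlgSpace k} {P : PoissonStr S} {L : S.Modules}

/-- A first-order deformation of `(L, ∇)` over the trivial Poisson deformation: a Poisson invertible
sheaf over `k[ε]` on the thickening together with an identification of its restriction to `S` (its
quotient by the multiples of `ε`, with the induced bracket) with `(L, ∇)`. The identification is
given by the quotient map `restr` from `mod` onto `L = mod / ε mod`. -/
structure FirstOrderDef (C : FlatConn P L) where
  mod : S.thick.Modules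
  invertible : IsInvertible mod
  conn : FlatConn P.thick mod
  restr : ∀ U : Opens S.space, Sec (S := S.thick) mod U →+ Sec L U
  restr_smul : ∀ U (f : S.thick.Fn U) (m : Sec mod U), restr U (f • m) = re f • restr U m
  restr_res : ∀ {U V : Opens S.space} (h : V ≤ U) (m : Sec (S := S.thick) mod U),
    restr V (resM mod h m) = resM L h (restr U m)
  restr_surjective : ∀ (U : Opens S.space) (l : Sec L U), ∀ x ∈ U, ∃ (V : Opens S.space)
    (h : V ≤ U) (m : Sec (S := S.thick) mod V), x ∈ V ∧ restr V m = resM L h l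
  restr_eq_zero : ∀ (U : Opens S.space) (m : Sec (S := S.thick) mod U), restr U m = 0 ↔
    ∀ x ∈ U, ∃ (V : Opens S.space) (h : V ≤ U) (n : Sec (S := S.thick) mod V),
      x ∈ V ∧ resM mod h m = (AlgSpace.dual 0 1 : S.thick.Fn V) • n
  restr_bracket : ∀ U (f : S.thick.Fn U) (m : Sec mod U),
    restr U (conn.bracket U f m) = C.bracket U (re f) (restr U m)

namespace FirstOrderDef

variable {C : FlatConn P L} (𝒟 : FirstOrderDef C)

/-- The restriction map from Poisson sections of the deformation to Poisson sections of `(L, ∇)`. -/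
def restrH0 : H0 𝒟.conn.complex →+ H0 C.complex where
  toFun s := ⟨𝒟.restr ⊤ (𝒟.conn.sec s), by
    refine Subtype.ext ?_
    funext V f
    change C.bracket V.1 f (resM L V.2 (𝒟.restr ⊤ (𝒟.conn.sec s))) = 0
    have h := congrArg (𝒟.restr V.1) (𝒟.conn.bracket_sec s V.1 (AlgSpace.dual f 0))
    rw [𝒟.restr_bracket, map_zero, 𝒟.restr_res] at h
    exact h⟩
  map_zero' := Subtype.ext (map_zero _)
  map_add' _ _ := Subtype.ext (map_add _ _ _)

/-- A Poisson section of `(L, ∇)` extends to the deformation. -/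
def Extends (s : H0 C.complex) : Prop := s ∈ 𝒟.restrH0.range

/-- The deformation corresponds to `a ∈ ℍ¹(𝒪)`: over some cover `U_x` it has free generators `e_x`,
with transition functions `f_xy + ε g_xy` (so that `e_y = (f_xy + ε g_xy) e_x`) and connection
`{h, e_x} = (T_x(h) + ε W_x(h)) e_x`, such that `a` is the class of the Čech cocycle
`({g_xy / f_xy}, {W_x})`. -/
def Corresponds (a : H1 P.toFlatConn.complex) : Prop :=
  ∃ (𝒰 : PtCover S.space)
    (e : ∀ x, Sec (S := S.thick) 𝒟.mod (𝒰.nbhd x))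
    (f : ∀ x y, (S.Fn (𝒰.nbhd x ⊓ 𝒰.nbhd y))ˣ)
    (g : ∀ x y, S.Fn (𝒰.nbhd x ⊓ 𝒰.nbhd y))
    (T W : ∀ x, derOn S.unit (𝒰.nbhd x))
    (hz : ((fun x y => g x y * ((f x y)⁻¹).val, W) :
      C1 P.toFlatConn.complex 𝒰) ∈ Z1 P.toFlatConn.complex 𝒰),
    (∀ x, IsFrame 𝒟.mod (e x)) ∧
    (∀ x y, resM 𝒟.mod inf_le_right (e y) =
      (AlgSpace.dual (f x y : S.Fn _) (g x y) : S.thick.Fn _) • resM 𝒟.mod inf_le_left (e x)) ∧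
    (∀ x (V : OpensIn (𝒰.nbhd x)) (h : S.Fn V.1),
      𝒟.conn.bracket V.1 (AlgSpace.dual h 0) (resM 𝒟.mod V.2 (e x)) =
        (AlgSpace.dual (asFn ((T x).1 V h)) (asFn ((W x).1 V h)) : S.thick.Fn V.1) •
          resM 𝒟.mod V.2 (e x)) ∧
    a = cls P.toFlatConn.complex 𝒰 ⟨_, hz⟩

end FirstOrderDef

end Deformation

end PoissonSheaf

end

namespace PoissonSheaf

namespace AlgSpace

/-! ### Local determination and gluing of functions and sections -/

section Local

variable {K : Type u} [CommRing K] {S : AlgSpace K}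

/-! Everything reduces to comparing `ε`-coefficients in local frames. Let `e_x` be the frames of the
deformation and `ē_x` their reductions modulo `ε`. Locally `s = a_x ē_x`, and the lifts of `s` to
the deformation are the sections `(a_x + ε b_x) e_x` with `b_x` arbitrary. So the only freedom lies
in the `b_x`, and it is recorded by the `0`-cochain `t_x = -b_x ē_x` with values in `L`.

These local lifts agree on overlaps iff `a_x = a_y f_xy` and `b_x = a_y g_xy + b_y f_xy`. The first
equation says that the `a_x ē_x` agree, which holds because `s` is global. Since `ē_y = f_xy ē_x`,
the second says `t_y - t_x = (g_xy / f_xy) s`. By the Leibniz rule, `{h, (a_x + ε b_x) e_x}` has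
coefficients `{h, a_x} + a_x T_x(h)` and `{h, b_x} + a_x W_x(h) + b_x T_x(h)`. The first vanishes
because `∇s = 0`; the second vanishes iff `v₀(t_x)(h) = W_x(h) s`. Thus a choice of the `b_x` giving
a global Poisson lift is the same as a cochain `t` whose coboundary is the cocycle representing
`m₁(a)(s)`.

The computation rests on `FlatConn.bracket_dual_smul` (the Leibniz rule in coordinates),
`FirstOrderDef.restr_coords_unique` (functions are determined by their products with `ē_x`, so
equations in `L` can be read as equations of functions) and `m1_cls_eq_zero_iff` (vanishing in the
direct limit means being a coboundary on a refinement). The two implications are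
`FirstOrderDef.m1_eq_zero_of_extends` and `FirstOrderDef.extends_of_m1_eq_zero`. -/

theorem fn_ext {U : Opens S.space} {f g : S.Fn U}
    (H : ∀ x ∈ U, ∃ (V : Opens S.space) (h : V ≤ U), x ∈ V ∧ S.res h f = S.res h g) : f = g := by
  choose! V h hx hV using fun x : U => H x.1 x.2
  refine TopCat.Sheaf.eq_of_locally_eq' S.sheaf V U (fun x => homOfLE (h x)) ?_ f g hV
  exact fun x hxU => Opens.mem_iSup.mpr ⟨⟨x, hxU⟩, hx _⟩

theorem sec_ext {M : S.Modules} {U : Opens S.space} {s t : Sec M U}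
    (H : ∀ x ∈ U, ∃ (V : Opens S.space) (h : V ≤ U), x ∈ V ∧ resM M h s = resM M h t) :
    s = t := by
  choose! V h hx hV using fun x : U => H x.1 x.2
  refine TopCat.Sheaf.eq_of_locally_eq' (C := AddCommGrpCat.{u})
    (⟨M.val.presheaf, M.isSheaf⟩ : TopCat.Sheaf AddCommGrpCat.{u} S.space)
    V U (fun x => homOfLE (h x)) ?_ s t hV
  exact fun x hxU => Opens.mem_iSup.mpr ⟨⟨x, hxU⟩, hx _⟩

theorem exists_glue {M : S.Modules} (𝒰 : PtCover S.space) (s : ∀ x, Sec M (𝒰.nbhd x))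
    (H : ∀ x y, resM M (inf_le_left : 𝒰.nbhd x ⊓ 𝒰.nbhd y ≤ _) (s x) =
      resM M inf_le_right (s y)) :
    ∃ t : Sec M ⊤, ∀ x, resM M le_top t = s x := by
  obtain ⟨t, ht, -⟩ := TopCat.Sheaf.existsUnique_gluing' (C := AddCommGrpCat.{u})
    (⟨M.val.presheaf, M.isSheaf⟩ : TopCat.Sheaf AddCommGrpCat.{u} S.space)
    𝒰.nbhd ⊤ (fun x => homOfLE le_top)
    (fun x _ => Opens.mem_iSup.mpr ⟨x, 𝒰.mem x⟩) s H
  exact ⟨t, ht⟩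

end Local

/-! ### Arithmetic of functions `a + ε b` on the thickening -/

section Dual

variable {k : Type u} [CommRing k] {S : AlgSpace k}

theorem dual_mul {U : Opens S.space} (a b c d : S.Fn U) :
    (dual a b * dual c d : S.thick.Fn U) = dual (a * c) (a * d + b * c) := rfl

theorem dual_add {U : Opens S.space} (a b c d : S.Fn U) :
    (dual a b + dual c d : S.thick.Fn U) = dual (a + c) (b + d) := rfl

theorem res_dual {U V : Opens S.space} (h : V ≤ U) (a b : S.Fn U) :
    S.thick.res h (dual a b) = dual (S.res h a) (S.res h b) := rfl

theorem re_dual {U : Opens S.space} (a b : S.Fn U) : re (dual a b) = a := rfl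

theorem im_dual {U : Opens S.space} (a b : S.Fn U) : im (dual a b) = b := rfl

theorem dual_zero {U : Opens S.space} : (dual 0 0 : S.thick.Fn U) = 0 := rfl

/-- Because `ε` is a scalar of `k[ε]`, linearity of a connection over the base ring lets it be
pulled out of brackets. -/
theorem const_eps (U : Opens S.space) :
    S.thick.const U (DualNumber.eps : DualNumber k) = dual 0 1 := by
  refine dual_ext ?_ ?_
  · exact map_zero (S.const U)
  · exact map_one (S.const U)

end Dual

end AlgSpace

open AlgSpace

/-! ### Vanishing of a Čech class in the direct limit -/

section Cech

variable {T : TopCat.{u}} (C : ShortComplex (TopCat.Presheaf AddCommGrpCat.{u} T))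

/-- In a directed limit an element is zero iff it already dies at some later stage, and in the
quotient at that stage dying means being a coboundary. -/
theorem cls_eq_zero_iff (𝒰 : PtCover T) (c : Z1 C 𝒰) :
    cls C 𝒰 c = 0 ↔ ∃ (𝒱 : PtCover T) (h : 𝒰 ≤ 𝒱) (t : C0 C 𝒱),
      d0 C 𝒱 t = (refineZ C h c).1 := by
  classical
  have key : ∀ (𝒱 : PtCover T) (h : 𝒰 ≤ 𝒱), cls C 𝒰 c = cls C 𝒱 (refineZ C h c) := fun 𝒱 h =>
    (AddCommGroup.DirectLimit.of_f (G := CechH1 C) (f := fun _ _ h => refine C h)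
      (hij := h) (x := QuotientAddGroup.mk c)).symm
  constructor
  · intro h
    -- Exactness of the limit needs the refinement maps to be functorial; on cocycles this is
    -- functoriality of restriction.
    have : DirectedSystem (CechH1 C) fun _ _ h => refine C h :=
      { map_self := fun 𝒱 x => by
          obtain ⟨c, rfl⟩ := QuotientAddGroup.mk_surjective x
          refine congrArg (QuotientAddGroup.mk (s := B1 C 𝒱)) (Subtype.ext (Prod.ext ?_ ?_))
          · exact funext fun x => funext fun y => rs_self _ _
          · exact funext fun x => rs_self _ _
        map_map := fun 𝒱 𝒲 𝒳 _ _ x => by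
          obtain ⟨c, rfl⟩ := QuotientAddGroup.mk_surjective x
          refine congrArg (QuotientAddGroup.mk (s := B1 C _)) (Subtype.ext (Prod.ext ?_ ?_))
          · exact funext fun x => funext fun y => rs_rs _ _ _ _
          · exact funext fun x => rs_rs _ _ _ _ }
    obtain ⟨𝒱, hle, h0⟩ := AddCommGroup.DirectLimit.of.zero_exact (G := CechH1 C)
      (f := fun _ _ h => refine C h) 𝒰 (QuotientAddGroup.mk c) h
    obtain ⟨t, ht⟩ := (QuotientAddGroup.eq_zero_iff (refineZ C hle c)).mp h0
    exact ⟨𝒱, hle, t, ht⟩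
  · rintro ⟨𝒱, h, t, ht⟩
    have h0 : (QuotientAddGroup.mk (refineZ C h c) : CechH1 C 𝒱) = 0 :=
      (QuotientAddGroup.eq_zero_iff (refineZ C h c)).mpr ⟨t, ht⟩
    rw [key 𝒱 h]
    exact (congrArg (AddCommGroup.DirectLimit.of (CechH1 C) (fun _ _ h => refine C h) 𝒱) h0).trans
      (map_zero _)

end Cech

/-! ### The connection in local coordinates and reduction modulo `ε` -/

section Deformation

variable {k : Type u} [CommRing k] {S : AlgSpace k} {P : PoissonStr S}

/-- By `k[ε]`-linearity the bracket with functions of the thickening is determined by the bracket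
with functions of `S`, so flatness of a section need only be tested on the latter. -/
theorem FlatConn.bracket_dual {M : S.thick.Modules} (C : FlatConn P.thick M) (U : Opens S.space)
    (f g : S.Fn U) (m : Sec M U) :
    C.bracket U (dual f g) m = C.bracket U (dual f 0) m +
      (dual 0 1 : S.thick.Fn U) • C.bracket U (dual g 0) m := by
  rw [← const_eps, ← C.scalar_left, ← C.add_left, const_eps, dual_mul, dual_add]
  congr 2 <;> ring

/-- The Leibniz rule, expanded in powers of `ε`. The vanishing of the two coefficients gives the two
conditions for a lift to be a Poisson section. -/
theorem FlatConn.bracket_dual_smul {M : S.thick.Modules} (C : FlatConn P.thick M)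
    {U : Opens S.space} {e : Sec M U} {h τ ω : S.Fn U}
    (H : C.bracket U (dual h 0) e = (dual τ ω : S.thick.Fn U) • e) (a b : S.Fn U) :
    C.bracket U (dual h 0) ((dual a b : S.thick.Fn U) • e) =
      (dual (P.bracket U h a + a * τ) (P.bracket U h b + a * ω + b * τ) : S.thick.Fn U) • e := by
  -- The extended bracket of `h + 0ε` with `a + bε` has `ε`-part `{h, b} + {0, a}`; the second term
  -- has to be discarded.
  have hz : P.bracket U 0 a = 0 := by
    have h := P.add_left U 0 0 a
    rw [add_zero] at h
    exact left_eq_add.mp h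
  rw [C.leibniz_right, H, smul_smul, ← add_smul]
  refine congrArg (· • e) (dual_ext rfl ?_)
  change (P.bracket U h b + P.bracket U 0 a) + (a * ω + b * τ) = _ + _ + _
  rw [hz]; ring

namespace FirstOrderDef

variable {L : S.Modules} {C : FlatConn P L} (𝒟 : FirstOrderDef C)

variable {U : Opens S.space} {e : Sec (S := S.thick) 𝒟.mod U}

theorem exists_coords (he : IsFrame 𝒟.mod e) {V : Opens S.space} (h : V ≤ U)
    (m : Sec (S := S.thick) 𝒟.mod V) :
    ∃ a b : S.Fn V, m = (dual a b : S.thick.Fn V) • resM 𝒟.mod h e := by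
  obtain ⟨r, hr⟩ := (he V h).2 m
  exact ⟨re r, im r, hr.symm⟩

theorem coords_unique (he : IsFrame 𝒟.mod e) {V : Opens S.space} (h : V ≤ U)
    {a b a' b' : S.Fn V} (H : (dual a b : S.thick.Fn V) • resM 𝒟.mod h e =
      (dual a' b' : S.thick.Fn V) • resM 𝒟.mod h e) : a = a' ∧ b = b' := by
  have := (he V h).1 H
  exact ⟨congrArg re this, congrArg im this⟩

theorem restr_coords {V : Opens S.space} (h : V ≤ U) (a b : S.Fn V) :
    𝒟.restr V ((dual a b : S.thick.Fn V) • resM 𝒟.mod h e) =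
      a • resM L h (𝒟.restr U e) := by
  rw [𝒟.restr_smul, 𝒟.restr_res, re_dual]

/-- If `a - a'` kills the reduced frame, then `(a - a') e` reduces to zero, hence is locally `ε`
times a section. Its coefficient in the frame `e` is then locally a multiple of `ε`, so `a - a'`
vanishes locally, and therefore on `V`. -/
theorem restr_coords_unique (he : IsFrame 𝒟.mod e) {V : Opens S.space} (h : V ≤ U)
    {a a' : S.Fn V} (H : a • resM L h (𝒟.restr U e) = a' • resM L h (𝒟.restr U e)) : a = a' := by
  have h0 : 𝒟.restr V ((dual (a - a') 0 : S.thick.Fn V) • resM 𝒟.mod h e) = 0 := by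
    rw [restr_coords, sub_smul, H, sub_self]
  rw [𝒟.restr_eq_zero] at h0
  refine fn_ext fun x hx => ?_
  obtain ⟨W, hW, n, hxW, hn⟩ := h0 x hx
  refine ⟨W, hW, hxW, ?_⟩
  -- In coordinates `ε (p + ε q) = ε p`, whose constant term is zero.
  obtain ⟨p, q, rfl⟩ := 𝒟.exists_coords he (hW.trans h) n
  rw [resM_smul, resM_resM, res_dual, smul_smul, dual_mul] at hn
  have := (𝒟.coords_unique he _ hn).1
  rwa [zero_mul, map_sub, sub_eq_zero] at this

/-- The reduction modulo `ε` of `FlatConn.bracket_dual_smul`: only the constant term `τ` of the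
connection survives on `L`. It serves both for the coordinate of `s` and for that of the cochain
`t`. -/
theorem bracket_restr {V : Opens S.space} {e : Sec (S := S.thick) 𝒟.mod V} {h τ ω : S.Fn V}
    (H : 𝒟.conn.bracket V (dual h 0) e = (dual τ ω : S.thick.Fn V) • e) (b : S.Fn V) :
    C.bracket V h (b • 𝒟.restr V e) = (P.bracket V h b + b * τ) • 𝒟.restr V e := by
  have := congrArg (𝒟.restr V) (𝒟.conn.bracket_dual_smul H b 0)
  rwa [𝒟.restr_bracket, 𝒟.restr_smul, 𝒟.restr_smul] at this

end FirstOrderDef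

end Deformation

/-! ### The vanishing of `m₁(a)(s)` as explicit equations -/

section Mult

variable {K : Type u} [CommRing K]

theorem PoissonStr.bracket_neg {S : AlgSpace K} (P : PoissonStr S) (U : Opens S.space)
    (f g : S.Fn U) : P.bracket U f (-g) = -P.bracket U f g :=
  map_neg (AddMonoidHom.mk' (P.bracket U f) (P.add_right U f)) g

variable {S : AlgSpace K} {P : PoissonStr S} {M : S.Modules}

theorem FlatConn.mem_H0 (C : FlatConn P M) {s : Sec M ⊤}
    (H : ∀ V (f : S.Fn V), C.bracket V f (resM M le_top s) = 0) : s ∈ H0 C.complex :=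
  Subtype.ext (funext fun V => funext fun f => H V.1 f)

/-- Puts the vanishing criterion for Čech classes into the language of sections: the two conditions
are the Čech part and the `v₀` part of the equation saying that `t` bounds the product of the
refined cocycle with `s`. -/
theorem m1_cls_eq_zero_iff (C : FlatConn P M) (𝒰 : PtCover S.space)
    (z : Z1 P.toFlatConn.complex 𝒰) (s : H0 C.complex) :
    m1 C (cls P.toFlatConn.complex 𝒰 z) s = 0 ↔
      ∃ (𝒱 : PtCover S.space) (h : 𝒰 ≤ 𝒱) (t : ∀ x, Sec M (𝒱.nbhd x)),
        (∀ x y, resM M (inf_le_right : 𝒱.nbhd x ⊓ 𝒱.nbhd y ≤ _) (t y) -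
            resM M inf_le_left (t x) =
          S.res (inf_le_inf (h x) (h y)) (asFn (z.1.1 x y)) • resM M le_top (C.sec s)) ∧
        (∀ x (V : Opens S.space) (hV : V ≤ 𝒱.nbhd x) (f : S.Fn V),
          C.bracket V f (resM M hV (t x)) =
            asFn ((z.1.2 x : derOn S.unit (𝒰.nbhd x)).1 ⟨V, hV.trans (h x)⟩ f) •
              resM M le_top (C.sec s)) := by
  have h1 : m1 C (cls P.toFlatConn.complex 𝒰 z) s =
      cls C.complex 𝒰 (mapZ (mulComplex C s) 𝒰 z) := mapH1_cls (mulComplex C s) 𝒰 z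
  rw [h1, cls_eq_zero_iff]
  refine exists_congr fun 𝒱 => exists_congr fun h => exists_congr fun t => ?_
  -- Multiplying by `s` and then restricting is the same as restricting the function and then
  -- multiplying.
  have h2 : ∀ x y, (refineZ C.complex h (mapZ (mulComplex C s) 𝒰 z)).1.1 x y =
      S.res (inf_le_inf (h x) (h y)) (asFn (z.1.1 x y)) • resM M le_top (C.sec s) := fun x y =>
    (resM_smul M (inf_le_inf (h x) (h y)) (asFn (z.1.1 x y)) (resM M le_top (C.sec s))).trans
      (congrArg _ (resM_resM M _ _ _))
  rw [Prod.ext_iff]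
  refine and_congr ?_ ?_
  · constructor
    · intro H x y
      exact (congrFun (congrFun H x) y).trans (h2 x y)
    · intro H
      funext x y
      exact (H x y).trans (h2 x y).symm
  · constructor
    · intro H x V hV f
      exact congrFun (congrFun (congrArg Subtype.val (congrFun H x)) ⟨V, hV⟩) f
    · intro H
      funext x
      exact Subtype.ext (funext fun V => funext fun f => H x V.1 V.2 f)

end Mult

/-! ### The two implications of the extension criterion -/

section Deformation

variable {k : Type u} [CommRing k] {S : AlgSpace k} {P : PoissonStr S}

namespace FirstOrderDef

variable {L : S.Modules} {C : FlatConn P L} (𝒟 : FirstOrderDef C)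

theorem resM_frame_trans {U U' : Opens S.space} {e : Sec (S := S.thick) 𝒟.mod U}
    {e' : Sec (S := S.thick) 𝒟.mod U'} {f g : S.Fn (U ⊓ U')}
    (H : resM 𝒟.mod inf_le_right e' =
      (dual f g : S.thick.Fn (U ⊓ U')) • resM 𝒟.mod inf_le_left e)
    {V : Opens S.space} (h : V ≤ U ⊓ U') :
    resM 𝒟.mod (h.trans inf_le_right) e' =
      (dual (S.res h f) (S.res h g) : S.thick.Fn V) • resM 𝒟.mod (h.trans inf_le_left) e := by
  rw [← resM_resM 𝒟.mod inf_le_right h, H, resM_smul, resM_resM, res_dual]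

/-- The `ε`-coefficients of an extension in the given frames supply the bounding cochain; no
refinement of the cover is needed. -/
theorem m1_eq_zero_of_extends {a : H1 P.toFlatConn.complex} (ha : 𝒟.Corresponds a)
    {s : H0 C.complex} (hs : 𝒟.Extends s) : m1 C a s = 0 := by
  obtain ⟨𝒰, e, f, g, T, W, hz, he, htr, hconn, rfl⟩ := ha
  obtain ⟨σ, rfl⟩ := hs
  rw [m1_cls_eq_zero_iff]
  choose a b hab using fun x => 𝒟.exists_coords (he x) le_rfl (resM 𝒟.mod le_top (𝒟.conn.sec σ))
  have hσ : ∀ x (V : Opens S.space) (h : V ≤ 𝒰.nbhd x), resM 𝒟.mod le_top (𝒟.conn.sec σ) =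
      (dual (S.res h (a x)) (S.res h (b x)) : S.thick.Fn V) • resM 𝒟.mod h (e x) := by
    intro x V h
    have := congrArg (resM 𝒟.mod h) (hab x)
    rwa [resM_resM, resM_smul, resM_resM, res_dual] at this
  have hs : ∀ x (V : Opens S.space) (h : V ≤ 𝒰.nbhd x),
      resM L le_top (C.sec (𝒟.restrH0 σ)) = S.res h (a x) • resM L h (𝒟.restr _ (e x)) := by
    intro x V h
    rw [← restr_coords 𝒟 h _ (S.res h (b x)), ← hσ, 𝒟.restr_res]; rfl
  -- The sign comes from the convention `t_y - t_x`: gluing gives `b_x - b_y f_xy = a_y g_xy`.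
  refine ⟨𝒰, le_rfl, fun x => -(b x • 𝒟.restr _ (e x)), ?_, ?_⟩
  · intro x y
    have htr' := 𝒟.resM_frame_trans (htr x y) le_rfl
    have htrL := congrArg (𝒟.restr _) htr'
    rw [restr_coords, 𝒟.restr_res] at htrL
    have h := (hσ x _ inf_le_left).symm.trans (hσ y (𝒰.nbhd x ⊓ 𝒰.nbhd y) inf_le_right)
    rw [htr', smul_smul, dual_mul] at h
    obtain ⟨-, h2⟩ := 𝒟.coords_unique (he x) _ h
    rw [hs y _ inf_le_right, map_neg, map_neg, resM_smul, resM_smul, htrL, h2, smul_smul,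
      smul_smul, smul_smul, neg_sub_neg, ← sub_smul]
    refine congrArg (· • _) ?_
    change _ = S.res _ (g x y * ((f x y)⁻¹).val) * _ * _
    -- Since `s = a_y f_xy ē_x`, the product `(g_xy / f_xy) s` becomes `a_y g_xy ē_x` once `f_xy` is
    -- cancelled.
    have hu : S.res le_rfl (f x y : S.Fn _) * S.res le_rfl ((f x y)⁻¹).val = 1 := by
      rw [← map_mul, Units.mul_inv, map_one]
    rw [map_mul]
    linear_combination (-S.res le_rfl (g x y) * S.res inf_le_right (a y)) * hu
  · intro x V hV h
    change C.bracket V h (resM L hV (-(b x • 𝒟.restr _ (e x)))) =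
      asFn ((W x).1 ⟨V, hV⟩ h) • resM L le_top (C.sec (𝒟.restrH0 σ))
    have hc := hconn x ⟨V, hV⟩ h
    have h0 := 𝒟.conn.bracket_sec σ V (dual h 0)
    -- Zero is rewritten as `(0 + ε 0) e_x`, so that uniqueness of coordinates yields the
    -- `ε`-equation `{h, b} + a W(h) + b T(h) = 0`.
    rw [hσ x V hV, 𝒟.conn.bracket_dual_smul hc, ← zero_smul (S.thick.Fn V), ← dual_zero] at h0
    obtain ⟨-, h2⟩ := 𝒟.coords_unique (he x) _ h0
    have hL := 𝒟.bracket_restr hc (-S.res hV (b x))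
    rw [hs x V hV, ← smul_neg, resM_smul, map_neg, smul_neg, ← neg_smul, ← 𝒟.restr_res, hL,
      smul_smul]
    refine congrArg (· • _) ?_
    rw [P.bracket_neg]
    linear_combination -h2

/-- A bounding cochain `t` prescribes the `ε`-coefficients of the local lifts. The Čech part of the
bounding equation makes the lifts glue, and the `v₀` part makes the glued section Poisson. -/
theorem extends_of_m1_eq_zero {a : H1 P.toFlatConn.complex} (ha : 𝒟.Corresponds a)
    {s : H0 C.complex} (hs : m1 C a s = 0) : 𝒟.Extends s := by
  obtain ⟨𝒰, e, f, g, T, W, hz, he, htr, hconn, rfl⟩ := ha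
  obtain ⟨𝒱, hle, t, ht, htW⟩ := (m1_cls_eq_zero_iff C 𝒰 _ s).mp hs
  -- Reduction modulo `ε` is surjective only locally, so writing `s` and `t_x` as multiples of the
  -- reduced frame may require a smaller neighbourhood of `x`.
  have hloc : ∀ x, ∃ (N : Opens S.space) (hN : N ≤ 𝒱.nbhd x) (a b : S.Fn N), x ∈ N ∧
      resM L le_top (C.sec s) = a • resM L (hN.trans (hle x)) (𝒟.restr _ (e x)) ∧
      resM L hN (t x) = -(b • resM L (hN.trans (hle x)) (𝒟.restr _ (e x))) := by
    intro x
    obtain ⟨N₁, h₁, m₁, hx₁, hm₁⟩ := 𝒟.restr_surjective _ (resM L le_top (C.sec s)) x (𝒱.mem x)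
    obtain ⟨N₂, h₂, m₂, hx₂, hm₂⟩ := 𝒟.restr_surjective _ (t x) x (𝒱.mem x)
    obtain ⟨a, a', ha⟩ := 𝒟.exists_coords (he x) (h₁.trans (hle x)) m₁
    obtain ⟨b, b', hb⟩ := 𝒟.exists_coords (he x) (h₂.trans (hle x)) m₂
    rw [ha, restr_coords, resM_resM] at hm₁
    rw [hb, restr_coords] at hm₂
    refine ⟨N₁ ⊓ N₂, inf_le_left.trans h₁, S.res inf_le_left a, -S.res inf_le_right b,
      ⟨hx₁, hx₂⟩, ?_, ?_⟩
    · have := congrArg (resM L (inf_le_left : N₁ ⊓ N₂ ≤ N₁)) hm₁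
      rw [resM_smul, resM_resM, resM_resM] at this
      exact this.symm
    · have := congrArg (resM L (inf_le_right : N₁ ⊓ N₂ ≤ N₂)) hm₂
      rw [resM_smul, resM_resM, resM_resM] at this
      rw [neg_smul, neg_neg]
      exact this.symm
  choose N hN a b hx hs ht' using hloc
  have hNU : ∀ x, N x ≤ 𝒰.nbhd x := fun x => (hN x).trans (hle x)
  have hsV : ∀ x (V : Opens S.space) (h : V ≤ N x), resM L le_top (C.sec s) =
      S.res h (a x) • resM L (h.trans (hNU x)) (𝒟.restr _ (e x)) := by
    intro x V h
    have := congrArg (resM L h) (hs x)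
    rwa [resM_smul, resM_resM, resM_resM] at this
  have htV : ∀ x (V : Opens S.space) (h : V ≤ N x), resM L (h.trans (hN x)) (t x) =
      (-S.res h (b x)) • resM L (h.trans (hNU x)) (𝒟.restr _ (e x)) := by
    intro x V h
    have := congrArg (resM L h) (ht' x)
    rwa [map_neg, resM_smul, resM_resM, resM_resM, ← neg_smul] at this
  -- Each `N x` still contains `x`, so the shrunken neighbourhoods cover. Gluing compares constant
  -- terms through the globality of `s` (`h1`) and `ε`-terms through the Čech equation for `t`
  -- (`h2`).
  obtain ⟨σ, hσ⟩ := exists_glue (S := S.thick) (M := 𝒟.mod) ⟨N, hx⟩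
    (fun x => (dual (a x) (b x) : S.thick.Fn (N x)) • resM 𝒟.mod (hNU x) (e x)) (by
      intro x y
      have hV : N x ⊓ N y ≤ 𝒰.nbhd x ⊓ 𝒰.nbhd y := inf_le_inf (hNU x) (hNU y)
      have htr' := 𝒟.resM_frame_trans (htr x y) hV
      have htrL := congrArg (𝒟.restr _) htr'
      rw [restr_coords, 𝒟.restr_res] at htrL
      have h1 := (hsV x _ inf_le_left).symm.trans (hsV y (N x ⊓ N y) inf_le_right)
      rw [htrL, smul_smul] at h1
      have h1 := 𝒟.restr_coords_unique (he x) _ h1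
      have h2 := congrArg (resM L (inf_le_inf (hN x) (hN y))) (ht x y)
      rw [map_sub, resM_resM, resM_resM, resM_smul, resM_resM, htV x _ inf_le_left,
        htV y _ inf_le_right, hsV y _ inf_le_right, htrL, smul_smul, smul_smul, smul_smul,
        ← sub_smul, res_res] at h2
      have h2 := 𝒟.restr_coords_unique (he x) _ h2
      change _ = S.res _ (g x y * ((f x y)⁻¹).val) * _ * _ at h2
      rw [map_mul] at h2
      have hu : S.res hV (f x y : S.Fn _) * S.res hV ((f x y)⁻¹).val = 1 := by
        rw [← map_mul, Units.mul_inv, map_one]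
      change resM 𝒟.mod (inf_le_left : N x ⊓ N y ≤ N x) _ =
        resM 𝒟.mod (inf_le_right : N x ⊓ N y ≤ N y) _
      rw [resM_smul, resM_smul, resM_resM, resM_resM, res_dual, res_dual, htr', smul_smul,
        dual_mul]
      refine congrArg (· • _) (dual_ext h1 ?_)
      change S.res _ (b x) = S.res _ (a y) * S.res hV (g x y) + S.res _ (b y) * S.res hV (f x y)
      linear_combination h2 + S.res hV (g x y) * S.res inf_le_right (a y) * hu)
  have hσV : ∀ x (V : Opens S.space) (h : V ≤ N x), resM 𝒟.mod le_top σ =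
      (dual (S.res h (a x)) (S.res h (b x)) : S.thick.Fn V) •
        resM 𝒟.mod (h.trans (hNU x)) (e x) := by
    intro x V h
    have := congrArg (resM 𝒟.mod h) (hσ x)
    rwa [resM_resM, resM_smul, resM_resM, res_dual] at this
  -- Vanishing is local, so it is checked on each `V ⊓ N x`, where the glued section has known
  -- coordinates.
  have hflat : ∀ V (h : S.Fn V), 𝒟.conn.bracket V (dual h 0) (resM 𝒟.mod le_top σ) = 0 := by
    intro V h
    refine sec_ext (S := S.thick) fun x hxV => ⟨V ⊓ N x, inf_le_left, ⟨hxV, hx x⟩, ?_⟩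
    have hVU : V ⊓ N x ≤ 𝒰.nbhd x := inf_le_right.trans (hNU x)
    rw [𝒟.conn.res_bracket, resM_resM, map_zero, res_dual, map_zero, hσV x _ inf_le_right]
    -- The remaining equations hold for every function on `V ⊓ N x`, so it no longer matters that
    -- `h` came from `V`.
    generalize S.res (inf_le_left : V ⊓ N x ≤ V) h = h
    have hc := hconn x ⟨V ⊓ N x, hVU⟩ h
    have hsb := C.bracket_sec s (V ⊓ N x) h
    have htb := htW x (V ⊓ N x) (inf_le_right.trans (hN x)) h
    rw [hsV x _ inf_le_right, ← 𝒟.restr_res, 𝒟.bracket_restr hc, 𝒟.restr_res,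
      ← zero_smul (S.Fn (V ⊓ N x))] at hsb
    have h1 := 𝒟.restr_coords_unique (he x) _ hsb
    rw [htV x _ inf_le_right, hsV x _ inf_le_right, ← 𝒟.restr_res, 𝒟.bracket_restr hc,
      𝒟.restr_res, smul_smul] at htb
    have h2 := 𝒟.restr_coords_unique (he x) _ htb
    rw [P.bracket_neg] at h2
    rw [𝒟.conn.bracket_dual_smul hc, ← zero_smul (S.thick.Fn (V ⊓ N x)), ← dual_zero]
    -- The constant term vanishes because `s` is Poisson, the `ε`-term because `v₀(t_x) = W_x ⊗ s`.
    refine congrArg (· • _) (dual_ext h1 ?_)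
    rw [im_dual, im_dual]
    linear_combination -h2
  refine ⟨⟨σ, 𝒟.conn.mem_H0 fun V F => ?_⟩, Subtype.ext ?_⟩
  · have h := 𝒟.conn.bracket_dual V (re F) (im F) (resM 𝒟.mod le_top σ)
    rw [hflat, hflat, smul_zero, add_zero] at h
    exact h
  · change 𝒟.restr ⊤ σ = C.sec s
    refine sec_ext fun x _ => ⟨N x, le_top, hx x, ?_⟩
    rw [hs x, ← 𝒟.restr_res, hσV x _ le_rfl, restr_coords, res_self]

end FirstOrderDef

end Deformation

end PoissonSheaf

/-! ### The extension criterion on a nonsingular variety -/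

open PoissonSheaf in
theorem mainTheorem10 {k : Type u} [Field k] [IsAlgClosed k] [CharZero k]
    (X : Scheme.{u}) (π : X ⟶ Spec (.of k)) [IsIntegral X] [Smooth π] [IsSeparated π]
    [LocallyOfFiniteType π] [QuasiCompact π]
    (P : PoissonStr (ofScheme X π))
    (L : (ofScheme X π).Modules) (hL : AlgSpace.IsInvertible L) (C : FlatConn P L)
    (a : H1 P.toFlatConn.complex) (𝒟 : FirstOrderDef C) (ha : 𝒟.Corresponds a)
    (s : H0 C.complex) :
    𝒟.Extends s ↔ m1 C a s = 0 :=
  ⟨𝒟.m1_eq_zero_of_extends ha, 𝒟.extends_of_m1_eq_zero ha⟩
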